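/- **Notation.** For a prime $p$, $\mathbb{Z}_{(p)}$ is the ring of rationals whose reduced denominator is prime to $p$, $\mathbb{Z}_{(p)}^*$ is its unit group and $v_p$ is the $p$-adic valuation. Let $(x)_m=x(x+1)\cdots(x+m-1)$, $(x)_0=1$. For $\gamma\in\mathbb{Z}_{(p)}$, $\mathfrak{D}_p(\gamma)$ is the unique element of $\mathbb{Z}_{(p)}$ with $p\mathfrak{D}_p(\gamma)-\gamma\in\{0,\dots,p-1\}$; $\mathfrak{D}_p^k$ is its $k$-th iterate, applied componentwise to vectors. For $\gamma\in\mathbb{Z}_{(p)}^n$ and $r\ge 0$ put $$\mathcal{P}_{\gamma,r}=\{s:(\gamma_s)_r\in p\mathbb{Z}_{(p)}\},\qquad \mathcal{C}_{\gamma,r}=\{s:(\gamma_s)_r\notin p\mathbb{Z}_{(p)}\}.$$ For $n\ge 1$, $\alpha=(\alpha_1,\dots,\alpha_n)$ and $\beta=(\beta_1,\dots,\beta_{n-1},1)$ (so $\beta_n=1$), put $\mathcal{Q}_{\alpha,\beta}(m)=\prod_{s=1}^n(\alpha_s)_m/(\beta_s)_m$ and ${}_nF_{n-1}(\alpha,\beta;z)=\sum_{m\ge0}\mathcal{Q}_{\alpha,\beta}(m)z^m$;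 let $d_{\alpha,\beta}$ be the least common multiple of the denominators of the $\alpha_i,\beta_j$, and let $S_{\alpha,\beta,p}$ be the set of $r\in\{0,\dots,p-1\}$ that are congruent modulo $p$ to one of $0,1-\beta_1,\dots,1-\beta_{n-1}$ and satisfy $v_p(\mathcal{Q}_{\alpha,\beta}(r))=0$. The couple $(\alpha,\beta)$ satisfies the $\mathbf{P}_{p,l}$ property if $\alpha,\beta\in\mathbb{Z}_{(p)}^n$ and, for every $k\in\{1,\dots,l\}$ and all $i,j,s\in\{1,\dots,n\}$: (P1) $\mathfrak{D}_p^k(\alpha_i),\mathfrak{D}_p^k(\beta_j)\in\mathbb{Z}_{(p)}^*$; (P2) $\mathfrak{D}_p^k(\alpha_i)-\mathfrak{D}_p^k(\beta_j)\in\mathbb{Z}_{(p)}^*$; (P3) $\mathfrak{D}_p^k(\beta_j)-\mathfrak{D}_p^k(\beta_s)\in\mathbb{Z}_{(p)}^*$ if and only if $\beta_j\ne\beta_s$; (P4) $p\mathfrak{D}_p^k(\beta_j)-\mathfrak{D}_p^{k-1}(\beta_j)\neq p-1$ whenever $\beta_j\neq1$; (P5) $1-\mathfrak{D}_p^k(\beta_j)+\mathfrak{D}_p^k(\alpha_i)$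 and $1-\mathfrak{D}_p^k(\beta_j)+\mathfrak{D}_p^k(\beta_i)$ belong to $\mathbb{Z}_{(p)}^*$. **Proposition.** Let $n\ge1$, let $\alpha=(\alpha_1,\dots,\alpha_n)$ and $\beta=(\beta_1,\dots,\beta_{n-1},1)$ be in $(\mathbb{Q}\cap(0,1])^n$ and let $p$ be a prime such that ${}_nF_{n-1}(\alpha,\beta;z)\in\mathbb{Z}_{(p)}[[z]]$. Suppose that $(\alpha,\beta)$ satisfies the $\mathbf{P}_{p,l}$ property, where $l$ is the order of $p$ in $(\mathbb{Z}/d_{\alpha,\beta}\mathbb{Z})^*$, and that all $\alpha_i$ and $\beta_j$ belong to $\mathbb{Z}_{(p)}^*$. Write $S_{\mathfrak{D}_p^{l-1}(\alpha),\mathfrak{D}_p^{l-1}(\beta),p}=\{r_0,\dots,r_t\}$ with distinct $r_j$ and $r_0=0$ and, for $0\le j\le t$, put $$f_j=\sum_{m\ge0}\frac{\prod_{s\in\mathcal{C}_{\mathfrak{D}_p^{l-1}(\alpha),r_j}}(\alpha_s)_m\prod_{s\in\mathcal{P}_{\mathfrak{D}_p^{l-1}(\alpha),r_j}}(\alpha_s+1)_m}{\prod_{s\in\mathcal{C}_{\mathfrak{D}_p^{l-1}(\beta),r_j}}(\beta_s)_m\prod_{s\in\mathcal{P}_{\mathfrak{D}_p^{l-1}(\beta),r_j}}(\beta_s+1)_m}\,z^m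 .$$ Then $f_i\in1+z\mathbb{Z}_{(p)}[[z]]$ for every $i\in\{0,\dots,t\}$, and there are polynomials $Q_{i,j}\in\mathbb{Z}_{(p)}[z]$ of degree less than $p^l$ $(0\le i,j\le t)$ such that, for every $i\in\{0,\dots,t\}$, $$f_i\equiv\sum_{j=0}^tQ_{i,j}(z)\,f_j^{p^l}\pmod{p\,\mathbb{Z}_{(p)}[[z]]}.$$ -/

import Mathlib

namespace HypergeometricModP

open Polynomial

/-- The localization `ℤ_(p)`: rational numbers whose reduced denominator is not divisible by `p`. -/
def Zloc (p : ℕ) [hp : Fact p.Prime] : Subring ℚ where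
  carrier := {x | ¬ p ∣ x.den}
  mul_mem' {a b} ha hb h :=
    (hp.out.dvd_mul.mp (h.trans (Rat.mul_den_dvd a b))).elim ha hb
  one_mem' h := hp.out.one_lt.ne' (Nat.dvd_one.mp h)
  add_mem' {a b} ha hb h :=
    (hp.out.dvd_mul.mp (h.trans (Rat.add_den_dvd a b))).elim ha hb
  zero_mem' h := hp.out.one_lt.ne' (Nat.dvd_one.mp h)
  neg_mem' {a} ha h := ha (by simpa using h)

/-- `x ∈ ℤ_(p)^*`. -/
def IsUnitLoc (p : ℕ) [Fact p.Prime] (x : ℚ) : Prop :=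
  ∃ u : (Zloc p)ˣ, ((u : Zloc p) : ℚ) = x

/-- `x ∈ p ℤ_(p)`. -/
def MemPZloc (p : ℕ) [Fact p.Prime] (x : ℚ) : Prop :=
  ∃ y ∈ Zloc p, x = p * y

/-- Dwork's map `𝔇_p`. For `γ ∈ ℤ_(p)`, it is the unique element of `ℤ_(p)` such that
`p 𝔇_p(γ) - γ ∈ {0, …, p - 1}`; see `dworkMap_spec` and `dworkMap_unique`. -/
noncomputable def dworkMap (p : ℕ) [Fact p.Prime] (γ : ℚ) : ℚ :=
  (γ + ((-(γ : ZMod p)).val : ℚ)) / p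

theorem dworkMap_spec (p : ℕ) [hp : Fact p.Prime] {γ : ℚ} (hγ : γ ∈ Zloc p) :
    dworkMap p γ ∈ Zloc p ∧ ∃ s : ℕ, s < p ∧ (p : ℚ) * dworkMap p γ - γ = s := by
  have hp0 : (p : ℚ) ≠ 0 := by exact_mod_cast hp.out.ne_zero
  have hd : ¬ p ∣ γ.den := hγ
  have hd0 : (γ.den : ZMod p) ≠ 0 := by rwa [Ne, ZMod.natCast_eq_zero_iff]
  have hdq : (γ.den : ℚ) ≠ 0 := by exact_mod_cast γ.den_nz
  set s : ℕ := (-(γ : ZMod p)).val with hs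
  have hsz : (s : ZMod p) = -(γ : ZMod p) := by rw [hs, ZMod.natCast_zmod_val]
  have hdvd : (p : ℤ) ∣ γ.num + s * γ.den := by
    rw [← ZMod.intCast_zmod_eq_zero_iff_dvd]
    push_cast
    rw [hsz, Rat.cast_def]
    field_simp
    ring
  refine ⟨?_, s, ZMod.val_lt _, ?_⟩
  · obtain ⟨k, hk⟩ := hdvd
    have e : dworkMap p γ = (k : ℚ) / (γ.den : ℤ) := by
      have hk' : (γ.num : ℚ) + s * γ.den = p * k := by exact_mod_cast hk
      have hg : γ * γ.den = γ.num := Rat.mul_den_eq_num γ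
      unfold dworkMap
      rw [← hs]
      push_cast
      rw [div_eq_div_iff hp0 hdq]
      linear_combination hg + hk'
    intro h
    rw [e] at h
    exact hd (h.trans (by exact_mod_cast Rat.den_dvd k γ.den))
  · unfold dworkMap
    rw [← hs]
    field_simp
    ring

theorem dworkMap_unique (p : ℕ) [hp : Fact p.Prime] {γ δ : ℚ} (hγ : γ ∈ Zloc p)
    (hδ : δ ∈ Zloc p) (h : ∃ s : ℕ, s < p ∧ (p : ℚ) * δ - γ = s) : δ = dworkMap p γ := by
  obtain ⟨hm, s', hs', h'⟩ := dworkMap_spec p hγ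
  obtain ⟨s, hs, h⟩ := h
  have hp0 : (p : ℚ) ≠ 0 := by exact_mod_cast hp.out.ne_zero
  have key : (p : ℚ) * (δ - dworkMap p γ) = ((s : ℤ) - s' : ℤ) := by
    push_cast; linear_combination h - h'
  have hsub : δ - dworkMap p γ ∈ Zloc p := sub_mem hδ hm
  set x := δ - dworkMap p γ with hx
  have hd : ¬ p ∣ x.den := hsub
  have hnum : (p : ℤ) * x.num = ((s : ℤ) - s') * x.den := by
    have hg : x * x.den = x.num := Rat.mul_den_eq_num x
    have : (p : ℚ) * x.num = (((s : ℤ) - s' : ℤ) : ℚ) * x.den := by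
      linear_combination (x.den : ℚ) * key - (p : ℚ) * hg
    exact_mod_cast this
  have hdv : (p : ℤ) ∣ ((s : ℤ) - s') * x.den := ⟨_, hnum.symm⟩
  have hdv2 : (p : ℤ) ∣ (s : ℤ) - s' := by
    rcases (Nat.prime_iff_prime_int.mp hp.out).dvd_or_dvd hdv with h1 | h1
    · exact h1
    · exact absurd (by exact_mod_cast h1) hd
  have hz : (s : ℤ) - s' = 0 := by
    apply Int.eq_zero_of_abs_lt_dvd hdv2
    rw [abs_lt]
    constructor <;> omega
  rw [hz] at key
  have : x = 0 := by simpa [hp0] using key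
  exact sub_eq_zero.mp this

/-- The Pochhammer symbol `(x)_m = x (x + 1) ⋯ (x + m - 1)`. -/
noncomputable def poch (x : ℚ) (m : ℕ) : ℚ := (ascPochhammer ℚ m).eval x

/-- `𝒬_{α,β}(m) = (α₁)_m ⋯ (αₙ)_m / ((β₁)_m ⋯ (βₙ)_m)`. It is used when the last entry of `β` is
`1`, so that the last factor of the denominator is `m!`. -/
noncomputable def hyperCoeff {n : ℕ} (α β : Fin n → ℚ) (m : ℕ) : ℚ :=
  (∏ s, poch (α s) m) / ∏ s, poch (β s) m

/-- The hypergeometric series `ₙFₙ₋₁(α, β; z)` (the last entry of `β` being `1`). -/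
noncomputable def hyperSeries {n : ℕ} (α β : Fin n → ℚ) : PowerSeries ℚ :=
  PowerSeries.mk (hyperCoeff α β)

/-- `f ∈ ℤ_(p)[[z]]`. -/
def IsIntegralSeries (p : ℕ) [Fact p.Prime] (f : PowerSeries ℚ) : Prop :=
  ∀ m, PowerSeries.coeff m f ∈ Zloc p

/-- `d_{α,β}`, the least common multiple of the denominators of the parameters
(the parameter `βₙ = 1` contributes a factor `1`). -/
def commonDen {n : ℕ} (α β : Fin n → ℚ) : ℕ :=
  Nat.lcm (Finset.univ.lcm fun i => (α i).den) (Finset.univ.lcm fun i => (β i).den)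

/-- `𝔇_p^k(γ)`, taken componentwise. -/
noncomputable def dworkIter (p : ℕ) [Fact p.Prime] {n : ℕ} (k : ℕ) (γ : Fin n → ℚ) : Fin n → ℚ :=
  fun i => (dworkMap p)^[k] (γ i)

/-- `E_{α,β,p}`: the `r ∈ {0, …, p - 1}` that reduce modulo `p` to one of the exponents
`1 - β₁, …, 1 - βₙ₋₁, 0 = 1 - βₙ` at zero of the hypergeometric operator modulo `p`. -/
def exponentSet (p : ℕ) [Fact p.Prime] {n : ℕ} (β : Fin n → ℚ) : Set ℕ :=
  {r | r < p ∧ ∃ j, MemPZloc p ((r : ℚ) - (1 - β j))}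

/-- `S_{α,β,p}`: the `r ∈ E_{α,β,p}` such that `v_p(𝒬_{α,β}(r)) = 0`. -/
def sSet (p : ℕ) [Fact p.Prime] {n : ℕ} (α β : Fin n → ℚ) : Set ℕ :=
  {r | r ∈ exponentSet p β ∧ hyperCoeff α β r ≠ 0 ∧ padicValRat p (hyperCoeff α β r) = 0}

open Classical in
/-- `𝒫_{γ,r} = {s : (γ_s)_r ∈ p ℤ_(p)}`. -/
noncomputable def pSet (p : ℕ) [Fact p.Prime] {n : ℕ} (γ : Fin n → ℚ) (r : ℕ) : Finset (Fin n) :=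
  Finset.univ.filter fun s => MemPZloc p (poch (γ s) r)

open Classical in
/-- `𝒞_{γ,r} = {s : (γ_s)_r ∉ p ℤ_(p)}`. -/
noncomputable def cSet (p : ℕ) [Fact p.Prime] {n : ℕ} (γ : Fin n → ℚ) (r : ℕ) : Finset (Fin n) :=
  Finset.univ.filter fun s => ¬ MemPZloc p (poch (γ s) r)

/-- The property `P_{p,l}` of the couple `(α, β)`. -/
structure PropertyP (p : ℕ) [Fact p.Prime] (l : ℕ) {n : ℕ} (α β : Fin n → ℚ) : Prop where
  memα : ∀ i, α i ∈ Zloc p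
  memβ : ∀ i, β i ∈ Zloc p
  P1 : ∀ k, 1 ≤ k → k ≤ l →
    (∀ i, IsUnitLoc p (dworkIter p k α i)) ∧ ∀ i, IsUnitLoc p (dworkIter p k β i)
  P2 : ∀ k, 1 ≤ k → k ≤ l →
    ∀ i j, IsUnitLoc p (dworkIter p k α i - dworkIter p k β j)
  P3 : ∀ k, 1 ≤ k → k ≤ l →
    ∀ j s, IsUnitLoc p (dworkIter p k β j - dworkIter p k β s) ↔ β j ≠ β s
  P4 : ∀ k, 1 ≤ k → k ≤ l →
    ∀ j, β j ≠ 1 → (p : ℚ) * dworkIter p k β j - dworkIter p (k - 1) β j ≠ (p : ℚ) - 1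
  P5 : ∀ k, 1 ≤ k → k ≤ l → ∀ i j,
    IsUnitLoc p (1 - dworkIter p k β j + dworkIter p k α i) ∧
    IsUnitLoc p (1 - dworkIter p k β j + dworkIter p k β i)

/-- The series attached to `r`: in `ₙFₙ₋₁(α, β; z)` the parameter `α_s` (resp. `β_s`) is replaced
by `α_s + 1` (resp. `β_s + 1`) when `s ∈ 𝒫_{𝔇_p^{l-1}(α),r}` (resp. `s ∈ 𝒫_{𝔇_p^{l-1}(β),r}`). -/
noncomputable def shiftedSeries (p : ℕ) [Fact p.Prime] (l : ℕ) {n : ℕ} (α β : Fin n → ℚ) (r : ℕ) :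
    PowerSeries ℚ :=
  PowerSeries.mk fun m =>
    ((∏ s ∈ cSet p (dworkIter p (l - 1) α) r, poch (α s) m) *
        ∏ s ∈ pSet p (dworkIter p (l - 1) α) r, poch (α s + 1) m) /
      ((∏ s ∈ cSet p (dworkIter p (l - 1) β) r, poch (β s) m) *
        ∏ s ∈ pSet p (dworkIter p (l - 1) β) r, poch (β s + 1) m)

end HypergeometricModP

/-! Among p consecutive numbers γ + j exactly one is divisible by p, and it equals p·𝔇_p(γ); by
Wilson's theorem the others multiply to -1 modulo p. Hence (γ)_{mp+r} is (γ)_r (-p)^m (𝔇_p(γ+r))_m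
up to a factor in 1 + pℤ_(p). Numerator and denominator have equally many parameters, so the powers
of -p cancel and 𝒬_{A,B}(mp+r) is 𝒬_{A,B}(r)·𝒬_{𝔇_p(A+r),𝔇_p(B+r)}(m) up to such a factor
(`hyperCoeff_mul_add`). For 0 ≤ r < p, 𝔇_p(γ+r) is 𝔇_p(γ) + 1 or 𝔇_p(γ) according as p divides (γ)_r
or not; so f_j is the series with parameters 𝔇_p(a+r_j), 𝔇_p(b+r_j), where a = 𝔇_p^{l-1}(α), b =
𝔇_p^{l-1}(β).

Along the orbit of (a, b) let G_{k,r} be the reduction of the series with parameters 𝔇_p(a_k+r),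
𝔇_p(b_k+r), which are those of level k+1 shifted by 0 or 1. Sort its coefficients by their last
base-p digit ρ. Either the coefficient at ρ vanishes modulo p, or ρ can be traded for an element s
of the set S of level k+1 producing the same shifts at level k+2 (`Admissible.hyperCoeff_shift`).
Thus G_{k,r} is a combination of the G_{k+1,s}(z^p) = G_{k+1,s}^p with polynomial coefficients of
degree less than p (`redSeries_step`).

Composing l such relations (`exists_iterate_relation`) returns to the starting level, since 𝔇_p^l
fixes every parameter (`isPeriodicPt_dworkMap`). The polynomials are then lifted from 𝔽_p to ℤ_(p).
-/

namespace HypergeometricModP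

open Polynomial

/-! ### Reduction modulo p, units and principal units of ℤ_(p). -/

section Reduction

variable {p : ℕ} [hp : Fact p.Prime]

theorem den_cast_ne_zero {x : ℚ} (hx : x ∈ Zloc p) : (x.den : ZMod p) ≠ 0 := by
  rwa [Ne, ZMod.natCast_eq_zero_iff]

theorem cast_add' {x y : ℚ} (hx : x ∈ Zloc p) (hy : y ∈ Zloc p) :
    ((x + y : ℚ) : ZMod p) = x + y :=
  Rat.cast_add_of_ne_zero (den_cast_ne_zero hx) (den_cast_ne_zero hy)

theorem cast_sub' {x y : ℚ} (hx : x ∈ Zloc p) (hy : y ∈ Zloc p) :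
    ((x - y : ℚ) : ZMod p) = x - y :=
  Rat.cast_sub_of_ne_zero (den_cast_ne_zero hx) (den_cast_ne_zero hy)

theorem cast_mul' {x y : ℚ} (hx : x ∈ Zloc p) (hy : y ∈ Zloc p) :
    ((x * y : ℚ) : ZMod p) = x * y :=
  Rat.cast_mul_of_ne_zero (den_cast_ne_zero hx) (den_cast_ne_zero hy)

variable (p) in
/-- Reduction modulo `p` on `ℤ_(p)`. -/
noncomputable def red : Zloc p →+* ZMod p where
  toFun x := ((x : ℚ) : ZMod p)
  map_one' := by simp
  map_mul' x y := cast_mul' x.2 y.2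
  map_zero' := by simp
  map_add' x y := cast_add' x.2 y.2

theorem red_apply (x : Zloc p) : red p x = ((x : ℚ) : ZMod p) := rfl

theorem natCast_mem_Zloc (n : ℕ) : (n : ℚ) ∈ Zloc p := natCast_mem _ n

theorem cast_prod' {ι : Type*} (s : Finset ι) {f : ι → ℚ} (hf : ∀ i ∈ s, f i ∈ Zloc p) :
    ((∏ i ∈ s, f i : ℚ) : ZMod p) = ∏ i ∈ s, (f i : ZMod p) := by
  classical
  induction s using Finset.induction_on with
  | empty => simp
  | insert a s ha ih =>
    rw [Finset.prod_insert ha, Finset.prod_insert ha, cast_mul', ih]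
    · exact fun i hi => hf i (Finset.mem_insert_of_mem hi)
    · exact hf a (Finset.mem_insert_self a s)
    · exact prod_mem fun i hi => hf i (Finset.mem_insert_of_mem hi)

theorem inv_mem_Zloc {x : ℚ} (hx0 : (x : ZMod p) ≠ 0) : x⁻¹ ∈ Zloc p := by
  intro h
  have hn : (x.num : ZMod p) = 0 := by
    rw [Rat.inv_def] at h
    rw [ZMod.intCast_zmod_eq_zero_iff_dvd]
    exact (Int.natCast_dvd_natCast.mpr h).trans (Rat.den_dvd _ _)
  apply hx0
  rw [Rat.cast_def, hn, zero_div]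

theorem cast_inv' {x : ℚ} (hx : x ∈ Zloc p) (hx0 : (x : ZMod p) ≠ 0) :
    ((x⁻¹ : ℚ) : ZMod p) = (x : ZMod p)⁻¹ := by
  have hx' : x ≠ 0 := by rintro rfl; simp at hx0
  have := cast_mul' hx (inv_mem_Zloc hx0)
  rw [mul_inv_cancel₀ hx'] at this
  exact eq_inv_of_mul_eq_one_right (by simpa using this.symm)

theorem isUnitLoc_iff {x : ℚ} : IsUnitLoc p x ↔ x ∈ Zloc p ∧ (x : ZMod p) ≠ 0 := by
  constructor
  · rintro ⟨u, rfl⟩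
    exact ⟨(u : Zloc p).2, (u.isUnit.map (red p)).ne_zero⟩
  · rintro ⟨h, h0⟩
    have hx' : x ≠ 0 := by rintro rfl; simp at h0
    exact ⟨⟨⟨x, h⟩, ⟨x⁻¹, inv_mem_Zloc h0⟩, Subtype.ext (mul_inv_cancel₀ hx'),
      Subtype.ext (inv_mul_cancel₀ hx')⟩, rfl⟩

theorem IsUnitLoc.mem {x : ℚ} (h : IsUnitLoc p x) : x ∈ Zloc p := (isUnitLoc_iff.mp h).1

theorem IsUnitLoc.cast_ne_zero {x : ℚ} (h : IsUnitLoc p x) : (x : ZMod p) ≠ 0 :=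
  (isUnitLoc_iff.mp h).2

theorem IsUnitLoc.ne_zero {x : ℚ} (h : IsUnitLoc p x) : x ≠ 0 := by
  rintro rfl
  exact h.cast_ne_zero (by simp)

theorem IsUnitLoc.mul {x y : ℚ} (hx : IsUnitLoc p x) (hy : IsUnitLoc p y) :
    IsUnitLoc p (x * y) := by
  rw [isUnitLoc_iff, cast_mul' hx.mem hy.mem]
  exact ⟨mul_mem hx.mem hy.mem, mul_ne_zero hx.cast_ne_zero hy.cast_ne_zero⟩

theorem IsUnitLoc.inv {x : ℚ} (hx : IsUnitLoc p x) : IsUnitLoc p x⁻¹ := by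
  rw [isUnitLoc_iff, cast_inv' hx.mem hx.cast_ne_zero]
  exact ⟨inv_mem_Zloc hx.cast_ne_zero, inv_ne_zero hx.cast_ne_zero⟩

theorem IsUnitLoc.prod {ι : Type*} (s : Finset ι) {f : ι → ℚ} (h : ∀ i ∈ s, IsUnitLoc p (f i)) :
    IsUnitLoc p (∏ i ∈ s, f i) := by
  rw [isUnitLoc_iff, cast_prod' s fun i hi => (h i hi).mem, Finset.prod_ne_zero_iff]
  exact ⟨prod_mem fun i hi => (h i hi).mem, fun i hi => (h i hi).cast_ne_zero⟩

theorem memPZloc_iff {x : ℚ} : MemPZloc p x ↔ x ∈ Zloc p ∧ (x : ZMod p) = 0 := by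
  have hp0 : (p : ℚ) ≠ 0 := by exact_mod_cast hp.out.ne_zero
  constructor
  · rintro ⟨y, hy, rfl⟩
    refine ⟨mul_mem (natCast_mem_Zloc p) hy, ?_⟩
    rw [cast_mul' (natCast_mem_Zloc p) hy]
    simp
  · rintro ⟨h, h0⟩
    have hd := den_cast_ne_zero h
    have hn : (p : ℤ) ∣ x.num := by
      rw [← ZMod.intCast_zmod_eq_zero_iff_dvd]
      rw [Rat.cast_def, div_eq_zero_iff] at h0
      exact h0.resolve_right hd
    obtain ⟨k, hk⟩ := hn
    refine ⟨(k : ℚ) / (x.den : ℤ), ?_, ?_⟩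
    · intro hdvd
      refine h (hdvd.trans ?_)
      exact_mod_cast Rat.den_dvd k x.den
    · nth_rw 1 [← Rat.num_div_den x]
      rw [hk]
      push_cast
      ring

theorem cast_pow_mul_eq_zero {x : ℚ} (hx : x ∈ Zloc p) (n : ℕ) (hn : n ≠ 0) :
    ((p ^ n * x : ℚ) : ZMod p) = 0 := by
  rw [cast_mul' (pow_mem (natCast_mem_Zloc p) n) hx]
  rw [← Nat.cast_pow]
  simp [hn]

theorem padicValRat_eq_zero_of_isUnitLoc {x : ℚ} (hx : IsUnitLoc p x) : padicValRat p x = 0 := by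
  have h1 : ¬ p ∣ x.den := hx.mem
  have h2 : ¬ (p : ℤ) ∣ x.num := by
    intro h
    apply hx.cast_ne_zero
    rw [Rat.cast_def, (ZMod.intCast_zmod_eq_zero_iff_dvd _ _).mpr h, zero_div]
  rw [padicValRat_def, padicValInt.eq_zero_of_not_dvd h2, padicValNat.eq_zero_of_not_dvd h1]
  simp

/-- The group `1 + p ℤ_(p)` of principal units. -/
def IsPrincipal (p : ℕ) [Fact p.Prime] (u : ℚ) : Prop := u ∈ Zloc p ∧ (u : ZMod p) = 1

theorem IsPrincipal.isUnitLoc {u : ℚ} (h : IsPrincipal p u) : IsUnitLoc p u :=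
  isUnitLoc_iff.mpr ⟨h.1, by rw [h.2]; exact one_ne_zero⟩

theorem isPrincipal_one : IsPrincipal p 1 := ⟨one_mem _, by simp⟩

theorem IsPrincipal.mul {u v : ℚ} (hu : IsPrincipal p u) (hv : IsPrincipal p v) :
    IsPrincipal p (u * v) :=
  ⟨mul_mem hu.1 hv.1, by rw [cast_mul' hu.1 hv.1, hu.2, hv.2, one_mul]⟩

theorem IsPrincipal.inv {u : ℚ} (hu : IsPrincipal p u) : IsPrincipal p u⁻¹ :=
  ⟨hu.isUnitLoc.inv.mem, by rw [cast_inv' hu.1 hu.isUnitLoc.cast_ne_zero, hu.2, inv_one]⟩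

theorem IsPrincipal.prod {ι : Type*} (s : Finset ι) {f : ι → ℚ}
    (h : ∀ i ∈ s, IsPrincipal p (f i)) : IsPrincipal p (∏ i ∈ s, f i) :=
  ⟨prod_mem fun i hi => (h i hi).1, by
    rw [cast_prod' s fun i hi => (h i hi).1, Finset.prod_congr rfl fun i hi => (h i hi).2,
      Finset.prod_const_one]⟩

end Reduction

/-! ### Pochhammer symbols. -/

section Poch

theorem poch_zero (x : ℚ) : poch x 0 = 1 := by simp [poch]

theorem poch_succ (x : ℚ) (m : ℕ) : poch x (m + 1) = poch x m * (x + m) :=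
  ascPochhammer_succ_eval m x

theorem poch_eq_prod (x : ℚ) (m : ℕ) : poch x m = ∏ j ∈ Finset.range m, (x + j) := by
  induction m with
  | zero => simp [poch_zero]
  | succ m ih => rw [poch_succ, ih, Finset.prod_range_succ]

theorem poch_add (x : ℚ) (m k : ℕ) : poch x (m + k) = poch x m * poch (x + m) k := by
  simp only [poch_eq_prod, Finset.prod_range_add]
  congr 1
  refine Finset.prod_congr rfl fun i _ => ?_
  push_cast
  ring

end Poch

/-! ### The Dwork map and the p-adic factorization of Pochhammer symbols. -/

section Dwork

variable {p : ℕ} [hp : Fact p.Prime]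

/-- The number `p 𝔇_p(γ) - γ ∈ {0, …, p - 1}`. -/
noncomputable def idx (p : ℕ) [Fact p.Prime] (γ : ℚ) : ℕ := (-(γ : ZMod p)).val

/-- Equals `1` if `idx p γ < r`, that is, if `p ∣ (γ)_r`, and `0` otherwise. -/
noncomputable def tau (p : ℕ) [Fact p.Prime] (γ : ℚ) (r : ℕ) : ℕ := if idx p γ < r then 1 else 0

theorem tau_le_one (γ : ℚ) (r : ℕ) : tau p γ r ≤ 1 := by unfold tau; split_ifs <;> simp

theorem idx_lt (γ : ℚ) : idx p γ < p := ZMod.val_lt _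

theorem idx_cast (γ : ℚ) : ((idx p γ : ℕ) : ZMod p) = -(γ : ZMod p) := ZMod.natCast_zmod_val _

theorem mul_dworkMap (γ : ℚ) : (p : ℚ) * dworkMap p γ = γ + idx p γ := by
  have hp0 : (p : ℚ) ≠ 0 := by exact_mod_cast hp.out.ne_zero
  unfold dworkMap idx
  field_simp

theorem dworkMap_mem {γ : ℚ} (hγ : γ ∈ Zloc p) : dworkMap p γ ∈ Zloc p := (dworkMap_spec p hγ).1

theorem dworkMap_add {γ : ℚ} (hγ : γ ∈ Zloc p) {r : ℕ} (hr : r ≤ p) :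
    dworkMap p (γ + r) = dworkMap p γ + tau p γ r := by
  symm
  refine dworkMap_unique p (add_mem hγ (natCast_mem_Zloc r))
    (add_mem (dworkMap_mem hγ) (natCast_mem_Zloc _)) ?_
  have h := mul_dworkMap (p := p) γ
  have hi := idx_lt (p := p) γ
  unfold tau
  split_ifs with hlt
  · refine ⟨idx p γ + p - r, by omega, ?_⟩
    rw [Nat.cast_sub (by omega)]
    push_cast
    linear_combination h
  · refine ⟨idx p γ - r, by omega, ?_⟩
    rw [Nat.cast_sub (by omega)]
    push_cast
    linear_combination h

theorem dworkMap_add_natCast_mul {γ : ℚ} (hγ : γ ∈ Zloc p) (k : ℕ) :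
    dworkMap p (γ + k * p) = dworkMap p γ + k := by
  symm
  refine dworkMap_unique p (add_mem hγ (mul_mem (natCast_mem_Zloc k) (natCast_mem_Zloc p)))
    (add_mem (dworkMap_mem hγ) (natCast_mem_Zloc _)) ⟨idx p γ, idx_lt γ, ?_⟩
  linear_combination mul_dworkMap (p := p) γ

theorem cast_add_natCast_ne_zero {γ : ℚ} (hγ : γ ∈ Zloc p) {j : ℕ} (hj : j < p)
    (hne : j ≠ idx p γ) : ((γ + j : ℚ) : ZMod p) ≠ 0 := by
  rw [cast_add' hγ (natCast_mem_Zloc j)]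
  intro h
  apply hne
  have : ((j : ℕ) : ZMod p) = (idx p γ : ℕ) := by
    rw [idx_cast]
    push_cast at h
    linear_combination h
  rwa [ZMod.natCast_eq_natCast_iff', Nat.mod_eq_of_lt hj, Nat.mod_eq_of_lt (idx_lt γ)] at this

/-- Wilson's theorem translated by c: the omitted index is the one at which c + j vanishes. -/
theorem prod_add_natCast_erase (c : ZMod p) :
    ∏ j ∈ (Finset.range p).erase (-c).val, (c + (j : ZMod p)) = -1 := by
  rw [← ZMod.prod_Ico_one_prime p]
  have hlt := hp.out.pos
  refine Finset.prod_bij' (fun j _ => (c + (j : ZMod p)).val)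
    (fun i _ => ((i : ZMod p) - c).val) ?_ ?_ ?_ ?_ ?_
  · intro j hj
    simp only [Finset.mem_erase, Finset.mem_range] at hj
    refine Finset.mem_Ico.mpr ⟨Nat.one_le_iff_ne_zero.mpr fun h => hj.1 ?_, ZMod.val_lt _⟩
    rw [ZMod.val_eq_zero] at h
    rw [← eq_neg_of_add_eq_zero_right h, ZMod.val_natCast, Nat.mod_eq_of_lt hj.2]
  · intro i hi
    rw [Finset.mem_Ico] at hi
    refine Finset.mem_erase.mpr ⟨fun h => ?_, Finset.mem_range.mpr (ZMod.val_lt _)⟩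
    have h2 := ZMod.val_injective p h
    have h3 : (i : ZMod p) = 0 := by linear_combination h2
    rw [ZMod.natCast_eq_zero_iff] at h3
    exact absurd (Nat.le_of_dvd hi.1 h3) (by omega)
  · intro j hj
    simp only [Finset.mem_erase, Finset.mem_range] at hj
    simp only [ZMod.natCast_zmod_val, add_sub_cancel_left]
    rw [ZMod.val_natCast, Nat.mod_eq_of_lt hj.2]
  · intro i hi
    rw [Finset.mem_Ico] at hi
    simp only [ZMod.natCast_zmod_val, add_sub_cancel]
    rw [ZMod.val_natCast, Nat.mod_eq_of_lt hi.2]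
  · intro j _
    simp

theorem poch_prime {γ : ℚ} (hγ : γ ∈ Zloc p) :
    ∃ u, IsPrincipal p u ∧ poch γ p = -p * dworkMap p γ * u := by
  have hmem : ∀ j ∈ (Finset.range p).erase (idx p γ), γ + (j : ℚ) ∈ Zloc p :=
    fun j _ => add_mem hγ (natCast_mem_Zloc j)
  refine ⟨-∏ j ∈ (Finset.range p).erase (idx p γ), (γ + j), ⟨neg_mem (prod_mem hmem), ?_⟩, ?_⟩
  · rw [Rat.cast_neg, cast_prod' _ hmem, ← neg_neg (1 : ZMod p), ← prod_add_natCast_erase (γ : ZMod p)]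
    congr 1
    refine Finset.prod_congr rfl fun j _ => ?_
    rw [cast_add' hγ (natCast_mem_Zloc j)]
    simp
  · rw [poch_eq_prod, ← Finset.mul_prod_erase _ _ (Finset.mem_range.mpr (idx_lt γ)),
      ← mul_dworkMap]
    ring

/-- After the first r factors, cut the rest into m blocks of length p. By `poch_prime` the block
starting at γ + r + ip contributes -p(𝔇_p(γ+r) + i) up to a principal unit. -/
theorem poch_mul_add {γ : ℚ} (hγ : γ ∈ Zloc p) (m r : ℕ) :
    ∃ u, IsPrincipal p u ∧
      poch γ (m * p + r) = poch γ r * (-p) ^ m * poch (dworkMap p (γ + r)) m * u := by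
  induction m with
  | zero => exact ⟨1, isPrincipal_one, by simp [poch_zero]⟩
  | succ m ih =>
    obtain ⟨u, hu, h⟩ := ih
    have hγr : γ + r ∈ Zloc p := add_mem hγ (natCast_mem_Zloc r)
    obtain ⟨v, hv, h'⟩ := poch_prime (p := p) (γ := γ + r + m * p)
      (add_mem hγr (mul_mem (natCast_mem_Zloc m) (natCast_mem_Zloc p)))
    refine ⟨u * v, hu.mul hv, ?_⟩
    rw [show (m + 1) * p + r = (m * p + r) + p by ring, poch_add, h,
      show γ + ((m * p + r : ℕ) : ℚ) = γ + r + m * p by push_cast; ring, h',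
      dworkMap_add_natCast_mul hγr, poch_succ]
    ring

theorem poch_eq_pow_tau_mul {γ : ℚ} (hγ : γ ∈ Zloc p) (hD : IsUnitLoc p (dworkMap p γ)) {r : ℕ}
    (hr : r ≤ p) : ∃ w, IsUnitLoc p w ∧ poch γ r = p ^ tau p γ r * w := by
  have hu : ∀ j, j < r → j ≠ idx p γ → IsUnitLoc p (γ + (j : ℚ)) := fun j hj hne =>
    isUnitLoc_iff.mpr ⟨add_mem hγ (natCast_mem_Zloc j),
      cast_add_natCast_ne_zero hγ (by omega) hne⟩
  unfold tau
  rw [poch_eq_prod]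
  split_ifs with h
  · refine ⟨_, hD.mul (IsUnitLoc.prod (f := fun j : ℕ => γ + (j : ℚ))
      ((Finset.range r).erase (idx p γ)) fun j hj => ?_), ?_⟩
    · rw [Finset.mem_erase, Finset.mem_range] at hj
      exact hu j hj.2 hj.1
    · rw [← Finset.mul_prod_erase _ _ (Finset.mem_range.mpr h), ← mul_dworkMap]
      ring
  · exact ⟨_, IsUnitLoc.prod (Finset.range r) fun j hj => hu j (Finset.mem_range.mp hj)
      (by have := Finset.mem_range.mp hj; omega), by simp⟩

theorem memPZloc_poch_iff {γ : ℚ} (hγ : γ ∈ Zloc p) (hD : IsUnitLoc p (dworkMap p γ)) {r : ℕ}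
    (hr : r ≤ p) : MemPZloc p (poch γ r) ↔ tau p γ r = 1 := by
  obtain ⟨w, hw, h⟩ := poch_eq_pow_tau_mul hγ hD hr
  rw [h, memPZloc_iff]
  rcases Nat.le_one_iff_eq_zero_or_eq_one.mp (tau_le_one (p := p) γ r) with h0 | h1
  · simp [h0, hw.cast_ne_zero]
  · rw [h1]
    exact iff_of_true ⟨mul_mem (pow_mem (natCast_mem_Zloc p) 1) hw.mem,
      cast_pow_mul_eq_zero hw.mem 1 one_ne_zero⟩ rfl

theorem idx_ne_zero {γ : ℚ} (h : IsUnitLoc p γ) : idx p γ ≠ 0 := by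
  intro h0
  apply h.cast_ne_zero
  have := idx_cast (p := p) γ
  rw [h0] at this
  simpa using this.symm

/-- A unit has positive index, so a shift by 1 does not pass the multiple of p: that multiple, hence
𝔇_p, is unchanged and only its position moves. This is how shifts from one level disappear at the
next. -/
theorem idx_add {γ : ℚ} (h : IsUnitLoc p γ) {e : ℕ} (he : e ≤ 1) :
    dworkMap p (γ + e) = dworkMap p γ ∧ idx p (γ + e) = idx p γ - e := by
  have h1 := idx_ne_zero h
  have hD : dworkMap p (γ + e) = dworkMap p γ := by
    rw [dworkMap_add h.mem (he.trans hp.out.one_lt.le), tau, if_neg (by omega)]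
    simp
  refine ⟨hD, ?_⟩
  have h2 := mul_dworkMap (p := p) (γ + e)
  rw [hD, mul_dworkMap] at h2
  have h3 : idx p γ = e + idx p (γ + e) := by
    have : (idx p γ : ℚ) = ((e + idx p (γ + e) : ℕ) : ℚ) := by
      push_cast
      linear_combination h2
    exact_mod_cast this
  omega

end Dwork

/-! ### Factorization and valuation of hypergeometric coefficients. -/

section HyperCoeff

variable {p : ℕ} [hp : Fact p.Prime]

theorem hyperCoeff_zero {n : ℕ} (A B : Fin n → ℚ) : hyperCoeff A B 0 = 1 := by
  simp [hyperCoeff, poch_zero]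

theorem prod_poch_mul_add {n : ℕ} {A : Fin n → ℚ} (hA : ∀ i, A i ∈ Zloc p) (m r : ℕ) :
    ∃ u, IsPrincipal p u ∧ ∏ s, poch (A s) (m * p + r) =
      (∏ s, poch (A s) r) * (∏ _s : Fin n, (-p : ℚ) ^ m) *
        (∏ s, poch (dworkMap p (A s + r)) m) * u := by
  choose u hu h using fun i => poch_mul_add (hA i) m r
  refine ⟨∏ i, u i, IsPrincipal.prod _ fun i _ => hu i, ?_⟩
  simp only [h, Finset.prod_mul_distrib]

theorem hyperCoeff_mul_add {n : ℕ} {A B : Fin n → ℚ} (hA : ∀ i, A i ∈ Zloc p)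
    (hB : ∀ i, B i ∈ Zloc p) (m r : ℕ) :
    ∃ u, IsPrincipal p u ∧ hyperCoeff A B (m * p + r) =
      hyperCoeff A B r *
        hyperCoeff (fun i => dworkMap p (A i + r)) (fun i => dworkMap p (B i + r)) m * u := by
  have hp0 : (p : ℚ) ≠ 0 := by exact_mod_cast hp.out.ne_zero
  obtain ⟨u, hu, h⟩ := prod_poch_mul_add hA m r
  obtain ⟨v, hv, h'⟩ := prod_poch_mul_add hB m r
  refine ⟨u * v⁻¹, hu.mul hv.inv, ?_⟩
  unfold hyperCoeff
  rw [h, h']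
  have hc : (∏ _s : Fin n, (-p : ℚ) ^ m) ≠ 0 :=
    Finset.prod_ne_zero_iff.mpr fun _ _ => pow_ne_zero _ (neg_ne_zero.mpr hp0)
  rw [mul_right_comm (∏ s, poch (A s) r), mul_right_comm (∏ s, poch (B s) r),
    mul_right_comm _ _ u, mul_right_comm _ _ v, mul_div_mul_right _ _ hc]
  simp only [div_eq_mul_inv, mul_inv]
  ring

/-- The valuation of 𝒬_{A,B}(r) is the number of A_i minus the number of B_i whose index is below r;
it is written without subtraction so that the exponents stay natural. -/
theorem hyperCoeff_eq_pow_tau {n : ℕ} {A B : Fin n → ℚ} (hA : ∀ i, A i ∈ Zloc p)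
    (hB : ∀ i, B i ∈ Zloc p) (hDA : ∀ i, IsUnitLoc p (dworkMap p (A i)))
    (hDB : ∀ i, IsUnitLoc p (dworkMap p (B i))) {r : ℕ} (hr : r ≤ p) :
    ∃ w, IsUnitLoc p w ∧
      p ^ (∑ i, tau p (B i) r) * hyperCoeff A B r = p ^ (∑ i, tau p (A i) r) * w := by
  have hp0 : (p : ℚ) ≠ 0 := by exact_mod_cast hp.out.ne_zero
  choose u hu h using fun i => poch_eq_pow_tau_mul (hA i) (hDA i) hr
  choose v hv h' using fun i => poch_eq_pow_tau_mul (hB i) (hDB i) hr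
  have hv0 := (IsUnitLoc.prod Finset.univ fun i _ => hv i)
  refine ⟨(∏ i, u i) * (∏ i, v i)⁻¹, (IsUnitLoc.prod _ fun i _ => hu i).mul hv0.inv, ?_⟩
  unfold hyperCoeff
  simp only [h, h', Finset.prod_mul_distrib, Finset.prod_pow_eq_pow_sum]
  have := hv0.ne_zero
  field_simp

end HyperCoeff

/-! ### Frobenius on power series over 𝔽_p and composition of relations. -/

section CharP

variable {p : ℕ} [hp : Fact p.Prime]

theorem powerSeries_pow_prime (G : PowerSeries (ZMod p)) :
    G ^ p = PowerSeries.expand p hp.out.ne_zero G := by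
  have h := MvPowerSeries.map_frobenius_expand (σ := Unit) (R := ZMod p) p hp.out.ne_zero (f := G)
  rw [ZMod.frobenius_zmod, MvPowerSeries.map_id] at h
  exact h.symm

/-- Since G^p = G(z^p) and q has degree less than p, only the base-p splitting of the exponent
contributes to the convolution. -/
theorem coeff_mul_pow_prime {q : (ZMod p)[X]} (hq : q.natDegree < p) (G : PowerSeries (ZMod p))
    (m : ℕ) {ρ : ℕ} (hρ : ρ < p) :
    PowerSeries.coeff (m * p + ρ) ((q : PowerSeries (ZMod p)) * G ^ p) =
      q.coeff ρ * PowerSeries.coeff m G := by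
  rw [powerSeries_pow_prime, PowerSeries.coeff_mul,
    Finset.sum_eq_single_of_mem (ρ, p * m) (by rw [Finset.HasAntidiagonal.mem_antidiagonal]; ring)]
  · rw [PowerSeries.coeff_expand_mul, Polynomial.coeff_coe]
  · rintro ⟨i, j⟩ hij hne
    rw [Finset.HasAntidiagonal.mem_antidiagonal] at hij
    simp only at hij ⊢
    by_cases hi : p ≤ i
    · rw [Polynomial.coeff_coe, Polynomial.coeff_eq_zero_of_natDegree_lt (hq.trans_le hi), zero_mul]
    · rw [PowerSeries.coeff_expand_of_not_dvd, mul_zero]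
      rintro ⟨k, rfl⟩
      apply hne
      have h1 : i = ρ := by
        have h := congrArg (· % p) hij
        simpa [Nat.add_mod, Nat.mod_eq_of_lt hρ, Nat.mod_eq_of_lt (not_le.mp hi)] using h
      subst h1
      rw [Prod.mk.injEq]
      refine ⟨rfl, ?_⟩
      have := mul_comm m p
      omega

/-- Substitute the relations of the next level into one step: raising to the p-th power is additive
in characteristic p, so they stay linear in the powers of the G's. The bound persists because (p -
1) + p(p^(l+1) - 1) = p^(l+2) - 1. The argument `l` encodes l + 1 steps. -/
theorem exists_iterate_relation (G : ℕ → ℕ → PowerSeries (ZMod p)) (I : ℕ → Finset ℕ)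
    (hI : ∀ k, ∀ r ∈ I k, r < p)
    (step : ∀ k r, r < p → ∃ q : ℕ → (ZMod p)[X], (∀ s, (q s).natDegree < p) ∧
      G k r = ∑ s ∈ I (k + 1), (q s : PowerSeries (ZMod p)) * G (k + 1) s ^ p)
    (l : ℕ) : ∀ k r, r < p → ∃ q : ℕ → (ZMod p)[X], (∀ s, (q s).natDegree < p ^ (l + 1)) ∧
      G k r = ∑ s ∈ I (k + (l + 1)),
        (q s : PowerSeries (ZMod p)) * G (k + (l + 1)) s ^ p ^ (l + 1) := by
  induction l with
  | zero => simpa using step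
  | succ l ih =>
    intro k r hr
    obtain ⟨q, hq, hG⟩ := step k r hr
    choose Q hQ hGQ using fun s (hs : s < p) => ih (k + 1) s hs
    let Q' : ℕ → ℕ → (ZMod p)[X] := fun s x => if h : s < p then Q s h x else 0
    have hQ' : ∀ s x, (Q' s x).natDegree < p ^ (l + 1) := by
      intro s x
      simp only [Q']
      split_ifs with h
      · exact hQ s h x
      · rw [natDegree_zero]
        exact pow_pos hp.out.pos _
    have hGQ' : ∀ s, s < p → G (k + 1) s = ∑ x ∈ I (k + (l + 1 + 1)),
        (Q' s x : PowerSeries (ZMod p)) * G (k + (l + 1 + 1)) x ^ p ^ (l + 1) := by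
      intro s hs
      rw [show k + (l + 1 + 1) = k + 1 + (l + 1) by ring]
      simpa only [Q', dif_pos hs] using hGQ s hs
    refine ⟨fun x => ∑ s ∈ I (k + 1), q s * Q' s x ^ p, fun x => ?_, ?_⟩
    · have hpos : 0 < p ^ (l + 1) := pow_pos hp.out.pos _
      have hle : (∑ s ∈ I (k + 1), q s * Q' s x ^ p).natDegree ≤ p ^ (l + 1 + 1) - 1 := by
        refine natDegree_sum_le_of_forall_le _ _ fun s _ => ?_
        refine natDegree_mul_le.trans ?_
        have h1 := hq s
        have h2 : (Q' s x ^ p).natDegree ≤ p * (p ^ (l + 1) - 1) :=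
          natDegree_pow_le.trans (Nat.mul_le_mul_left _ (Nat.le_sub_one_of_lt (hQ' s x)))
        have h3 : p * (p ^ (l + 1) - 1) + p = p ^ (l + 1 + 1) := by
          rw [← Nat.mul_succ, Nat.succ_eq_add_one, Nat.sub_add_cancel hpos, ← pow_succ']
        omega
      exact hle.trans_lt (Nat.sub_one_lt (pow_pos hp.out.pos _).ne')
    · have : CharP (PowerSeries (ZMod p)) p :=
        charP_of_injective_ringHom (PowerSeries.C_injective (R := ZMod p)) p
      rw [hG, Finset.sum_congr rfl fun s hs => by rw [hGQ' s (hI _ s hs), sum_pow_char]]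
      simp only [Finset.mul_sum, mul_pow, ← pow_mul, ← pow_succ]
      rw [Finset.sum_comm]
      refine Finset.sum_congr rfl fun x _ => ?_
      rw [← Polynomial.coeToPowerSeries.ringHom_apply, map_sum, Finset.sum_mul]
      refine Finset.sum_congr rfl fun s _ => ?_
      simp [mul_assoc]

end CharP

/-! ### Trading a digit for an exponent. -/

section Combinatorics

/-- X and Y are the indices of the numerator and denominator parameters, lowered by e and e' after a
shift. The threshold r is one more than the largest Y whose lowered value is below ρ, or 0 if there
is none. An X below r lies strictly below that Y, so it is below ρ even without being lowered. -/
theorem exists_threshold {ι : Type*} [Fintype ι] (X Y e e' : ι → ℕ)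
    (he' : ∀ j, e' j ≤ 1) (hXY : ∀ i j, X i ≠ Y j) (hYY : ∀ i j, Y i + 1 ≠ Y j)
    (hYe : ∀ i j, Y i = Y j → e' i = e' j) {ρ : ℕ} :
    ∃ r, (r = 0 ∨ ∃ j, r = Y j + 1 ∧ Y j - e' j < ρ) ∧ (∀ j, Y j - e' j < ρ ↔ Y j < r) ∧
      ∀ i, X i < r → X i - e i < ρ := by
  classical
  rcases (Finset.univ.filter fun j => Y j - e' j < ρ).eq_empty_or_nonempty with h | h
  · refine ⟨0, Or.inl rfl, fun j => ?_, fun i hi => by omega⟩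
    have : j ∉ Finset.univ.filter fun j => Y j - e' j < ρ := by simp [h]
    simp only [Finset.mem_filter, Finset.mem_univ, true_and] at this
    omega
  · obtain ⟨j₀, hj₀, hmax⟩ := Finset.exists_max_image _ Y h
    simp only [Finset.mem_filter, Finset.mem_univ, true_and] at hj₀ hmax
    refine ⟨Y j₀ + 1, Or.inr ⟨j₀, rfl, hj₀⟩, fun j => ⟨fun hj => ?_, fun hj => ?_⟩, fun i hi => ?_⟩
    · have := hmax j hj
      omega
    · have h1 := he' j₀
      have h2 := hYY j j₀
      have h3 := hYe j j₀
      by_cases h4 : Y j = Y j₀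
      · rw [h4, h3 h4]
        exact hj₀
      · omega
    · have h1 := he' j₀
      have h2 := hXY i j₀
      omega

end Combinatorics

/-- The conditions on a couple of parameter vectors under which one step of the Dwork map
produces a congruence between the associated hypergeometric series. -/
structure Admissible (p : ℕ) [Fact p.Prime] {n : ℕ} (a b : Fin n → ℚ) : Prop where
  unit_a : ∀ i, IsUnitLoc p (a i)
  unit_b : ∀ i, IsUnitLoc p (b i)
  unit_Da : ∀ i, IsUnitLoc p (dworkMap p (a i))
  unit_Db : ∀ i, IsUnitLoc p (dworkMap p (b i))
  unit_sub_ab : ∀ i j, IsUnitLoc p (a i - b j)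
  unit_sub_bb : ∀ i j, b i ≠ b j → IsUnitLoc p (b i - b j)
  unit_one_sub_bb : ∀ i j, IsUnitLoc p (1 - b j + b i)
  idx_ne : ∀ j, b j ≠ 1 → (p : ℚ) * dworkMap p (b j) - b j ≠ (p : ℚ) - 1
  exists_eq_one : ∃ j, b j = 1
  injOn : ∀ i j, dworkMap p (b i) = dworkMap p (b j) → b i = b j
  coeff_mem : ∀ r, r < p → hyperCoeff a b r ∈ Zloc p

/-- A vector of shifts in `{0, 1}` compatible with the coincidences among the entries of `b`
and vanishing on the entries equal to `1`. -/
structure CompatShift {n : ℕ} (b : Fin n → ℚ) (e : Fin n → ℕ) : Prop where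
  le_one : ∀ j, e j ≤ 1
  congr : ∀ i j, b i = b j → e i = e j
  of_eq_one : ∀ j, b j = 1 → e j = 0

/-! ### Valuations of the coefficients of shifted couples. -/

section Admissible

variable {p : ℕ} [hp : Fact p.Prime]

theorem dworkMap_one : dworkMap p 1 = 1 := by
  symm
  have := hp.out.pos
  refine dworkMap_unique p (one_mem _) (one_mem _) ⟨p - 1, by omega, ?_⟩
  rw [Nat.cast_sub hp.out.one_lt.le]
  simp

theorem idx_one : idx p 1 = p - 1 := by
  have h := mul_dworkMap (p := p) 1
  rw [dworkMap_one] at h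
  have : p = 1 + idx p 1 := by exact_mod_cast (mul_one (p : ℚ)).symm.trans h
  omega

variable {n : ℕ} {a b : Fin n → ℚ}

/-- Integrality of 𝒬(r), read as nonnegativity of its valuation. -/
theorem Admissible.sum_tau_le (h : Admissible p a b) {r : ℕ} (hr : r < p) :
    ∑ i, tau p (b i) r ≤ ∑ i, tau p (a i) r := by
  have hp0 : (p : ℚ) ≠ 0 := by exact_mod_cast hp.out.ne_zero
  obtain ⟨w, hw, heq⟩ := hyperCoeff_eq_pow_tau (fun i => (h.unit_a i).mem)
    (fun i => (h.unit_b i).mem) h.unit_Da h.unit_Db hr.le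
  by_contra! hlt
  obtain ⟨k, hk⟩ := Nat.exists_eq_add_of_lt hlt
  apply hw.cast_ne_zero
  have : w = (p : ℚ) ^ (k + 1) * hyperCoeff a b r := by
    apply mul_left_cancel₀ (pow_ne_zero (∑ i, tau p (a i) r) hp0)
    rw [← heq, hk]
    ring
  rw [this]
  exact cast_pow_mul_eq_zero (h.coeff_mem r hr) _ k.succ_ne_zero

theorem Admissible.idx_succ_lt (h : Admissible p a b) {j : Fin n} (hj : b j ≠ 1) :
    idx p (b j) + 1 < p := by
  have h1 := idx_lt (p := p) (b j)
  by_contra! h2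
  apply h.idx_ne j hj
  have h3 : p = idx p (b j) + 1 := by omega
  have h4 : (p : ℚ) = idx p (b j) + 1 := by exact_mod_cast h3
  linear_combination mul_dworkMap (p := p) (b j) - h4

theorem Admissible.idx_eq_iff (h : Admissible p a b) (i j : Fin n) :
    idx p (b i) = idx p (b j) ↔ b i = b j := by
  refine ⟨fun hij => ?_, fun hij => by rw [hij]⟩
  by_contra hne
  apply (h.unit_sub_bb i j hne).cast_ne_zero
  have h1 := idx_cast (p := p) (b i)
  rw [hij, idx_cast] at h1
  rw [cast_sub' (h.unit_b i).mem (h.unit_b j).mem]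
  linear_combination h1

theorem Admissible.exists_exponent (h : Admissible p a b) {e e' : Fin n → ℕ}
    (he : ∀ i, e i ≤ 1) (he' : CompatShift b e') {ρ : ℕ} (hρ : ρ < p) :
    ∃ r ∈ exponentSet p b, (∀ j, tau p (b j + e' j) ρ = tau p (b j) r) ∧
      ∀ i, tau p (a i) r ≤ tau p (a i + e i) ρ := by
  have hXY : ∀ i j, idx p (a i) ≠ idx p (b j) := by
    intro i j hij
    apply (h.unit_sub_ab i j).cast_ne_zero
    have h1 := idx_cast (p := p) (a i)
    rw [hij, idx_cast] at h1
    rw [cast_sub' (h.unit_a i).mem (h.unit_b j).mem]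
    linear_combination h1
  have hYY : ∀ i j, idx p (b i) + 1 ≠ idx p (b j) := by
    intro i j hij
    apply (h.unit_one_sub_bb j i).cast_ne_zero
    have h1 := idx_cast (p := p) (b j)
    rw [← hij] at h1
    push_cast at h1
    rw [idx_cast] at h1
    rw [cast_add' (sub_mem (one_mem _) (h.unit_b i).mem) (h.unit_b j).mem,
      cast_sub' (one_mem _) (h.unit_b i).mem]
    push_cast
    linear_combination h1
  obtain ⟨r, hr, hb, ha⟩ := exists_threshold (fun i => idx p (a i)) (fun j => idx p (b j)) e e'
    (ρ := ρ) he'.le_one hXY hYY fun i j hij => he'.congr i j ((h.idx_eq_iff i j).mp hij)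
  refine ⟨r, ?_, fun j => ?_, fun i => ?_⟩
  · rcases hr with rfl | ⟨j, rfl, hj⟩
    · obtain ⟨j, hj⟩ := h.exists_eq_one
      exact ⟨hp.out.pos, j, 0, zero_mem _, by simp [hj]⟩
    · have hj1 : b j ≠ 1 := by
        intro hj1
        rw [hj1, idx_one, he'.of_eq_one j hj1] at hj
        omega
      refine ⟨h.idx_succ_lt hj1, j, dworkMap p (b j), (h.unit_Db j).mem, ?_⟩
      rw [mul_dworkMap]
      push_cast
      ring
  · simp only [tau, (idx_add (h.unit_b j) (he'.le_one j)).2, hb]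
  · simp only [tau, (idx_add (h.unit_a i) (he i)).2]
    have := ha i
    split_ifs <;> simp_all

/-- With r the exponent traded for ρ, the valuation of the shifted coefficient at ρ is at least that
of 𝒬_{a,b}(r), which is nonnegative. If it is zero, both inequalities are equalities: then r lies in
S, and the numerator patterns, compared termwise, coincide. -/
theorem Admissible.hyperCoeff_shift (h : Admissible p a b) {e e' : Fin n → ℕ}
    (he : ∀ i, e i ≤ 1) (he' : CompatShift b e') {ρ : ℕ} (hρ : ρ < p) :
    hyperCoeff (fun i => a i + e i) (fun i => b i + e' i) ρ ∈ Zloc p ∧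
      (((hyperCoeff (fun i => a i + e i) (fun i => b i + e' i) ρ : ℚ) : ZMod p) = 0 ∨
        ∃ r ∈ sSet p a b, (∀ j, tau p (b j + e' j) ρ = tau p (b j) r) ∧
          ∀ i, tau p (a i + e i) ρ = tau p (a i) r) := by
  have hp0 : (p : ℚ) ≠ 0 := by exact_mod_cast hp.out.ne_zero
  obtain ⟨r, hr, hb, ha⟩ := h.exists_exponent he he' hρ
  obtain ⟨w, hw, heq⟩ := hyperCoeff_eq_pow_tau (p := p) (A := fun i => a i + e i)
    (B := fun i => b i + e' i) (fun i => add_mem (h.unit_a i).mem (natCast_mem_Zloc _))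
    (fun i => add_mem (h.unit_b i).mem (natCast_mem_Zloc _))
    (fun i => by rw [(idx_add (h.unit_a i) (he i)).1]; exact h.unit_Da i)
    (fun i => by rw [(idx_add (h.unit_b i) (he'.le_one i)).1]; exact h.unit_Db i) hρ.le
  have hle : ∑ i, tau p (a i) r ≤ ∑ i, tau p (a i + e i) ρ :=
    Finset.sum_le_sum fun i _ => ha i
  have hle' := h.sum_tau_le hr.1
  have hsum : ∑ i, tau p (b i + e' i) ρ = ∑ i, tau p (b i) r :=
    Finset.sum_congr rfl fun i _ => hb i
  obtain ⟨k, hk⟩ := Nat.exists_eq_add_of_le (hsum.trans_le (hle'.trans hle))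
  have hQ : hyperCoeff (fun i => a i + e i) (fun i => b i + e' i) ρ = (p : ℚ) ^ k * w := by
    apply mul_left_cancel₀ (pow_ne_zero (∑ i, tau p (b i + e' i) ρ) hp0)
    rw [heq, hk]
    ring
  rw [hQ]
  refine ⟨mul_mem (pow_mem (natCast_mem_Zloc p) k) hw.mem, ?_⟩
  by_cases hk0 : k = 0
  · right
    have hEq : ∑ i, tau p (a i) r = ∑ i, tau p (a i + e i) ρ := by omega
    refine ⟨r, ⟨hr, ?_⟩, hb, fun i =>
      ((Finset.sum_eq_sum_iff_of_le fun i _ => ha i).mp hEq i (Finset.mem_univ i)).symm⟩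
    obtain ⟨v, hv, hvq⟩ := hyperCoeff_eq_pow_tau (fun i => (h.unit_a i).mem)
      (fun i => (h.unit_b i).mem) h.unit_Da h.unit_Db hr.1.le
    have hbe : ∑ i, tau p (b i) r = ∑ i, tau p (a i) r := by omega
    rw [hbe] at hvq
    rw [mul_left_cancel₀ (pow_ne_zero _ hp0) hvq]
    exact ⟨hv.ne_zero, padicValRat_eq_zero_of_isUnitLoc hv⟩
  · exact Or.inl (cast_pow_mul_eq_zero hw.mem k hk0)

theorem Admissible.compatShift_tau (h : Admissible p a b) {r : ℕ} (hr : r < p) :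
    CompatShift (fun j => dworkMap p (b j)) fun j => tau p (b j) r where
  le_one j := tau_le_one _ _
  congr i j hij := by rw [h.injOn i j hij]
  of_eq_one j hj := by
    obtain ⟨i, hi⟩ := h.exists_eq_one
    have hj1 : b j = 1 := by
      rw [← hi]
      apply h.injOn
      rw [hi, dworkMap_one]
      exact hj
    rw [hj1, tau, idx_one, if_neg (by omega)]

end Admissible

/-! ### Integrality and the one-step relation along an orbit of the Dwork map. -/

section Chain

variable {p : ℕ} [hp : Fact p.Prime] {n : ℕ} {a b : ℕ → Fin n → ℚ}

theorem dworkMap_shift {x : ℚ} (hx : IsUnitLoc p x) {e ρ : ℕ} (he : e ≤ 1) (hρ : ρ < p) :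
    dworkMap p (x + e + ρ) = dworkMap p x + tau p (x + e) ρ := by
  rw [dworkMap_add (add_mem hx.mem (natCast_mem_Zloc e)) hρ.le, (idx_add hx he).1]

/-- Strong induction on m, simultaneously for all levels: removing the last digit passes from level
k to level k + 1. The new denominator shift is compatible because it is also the pattern of an
unshifted exponent r. -/
theorem hyperCoeff_shift_mem (h : ∀ k, Admissible p (a k) (b k))
    (ha : ∀ k i, a (k + 1) i = dworkMap p (a k i)) (hb : ∀ k i, b (k + 1) i = dworkMap p (b k i))
    (m : ℕ) : ∀ k (e e' : Fin n → ℕ), (∀ i, e i ≤ 1) → CompatShift (b k) e' →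
      hyperCoeff (fun i => a k i + e i) (fun i => b k i + e' i) m ∈ Zloc p := by
  induction m using Nat.strong_induction_on with
  | _ m ih =>
    intro k e e' he he'
    rcases Nat.eq_zero_or_pos m with rfl | hm
    · rw [hyperCoeff_zero]
      exact one_mem _
    have hρ : m % p < p := Nat.mod_lt _ hp.out.pos
    obtain ⟨u, hu, hm'⟩ := hyperCoeff_mul_add (p := p) (A := fun i => a k i + e i)
      (B := fun i => b k i + e' i) (fun i => add_mem ((h k).unit_a i).mem (natCast_mem_Zloc _))
      (fun i => add_mem ((h k).unit_b i).mem (natCast_mem_Zloc _)) (m / p) (m % p)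
    rw [Nat.div_add_mod'] at hm'
    rw [hm']
    refine mul_mem (mul_mem ((h k).hyperCoeff_shift he he' hρ).1 ?_) hu.1
    have h1 : ∀ i, dworkMap p (a k i + e i + (m % p : ℕ)) =
        a (k + 1) i + tau p (a k i + e i) (m % p) := fun i => by
      rw [dworkMap_shift ((h k).unit_a i) (he i) hρ, ha]
    obtain ⟨r, hr, hbr, -⟩ := (h k).exists_exponent he he' hρ
    have h2 : ∀ i, dworkMap p (b k i + e' i + (m % p : ℕ)) =
        b (k + 1) i + tau p (b k i) r := fun i => by
      rw [dworkMap_shift ((h k).unit_b i) (he'.le_one i) hρ, hb, hbr]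
    simp only [h1, h2]
    refine ih _ (Nat.div_lt_self hm hp.out.one_lt) (k + 1) _ _ (fun i => tau_le_one _ _) ?_
    rw [funext (hb k)]
    exact (h k).compatShift_tau hr.1

theorem hyperCoeff_dworkMap_mem (h : ∀ k, Admissible p (a k) (b k))
    (ha : ∀ k i, a (k + 1) i = dworkMap p (a k i)) (hb : ∀ k i, b (k + 1) i = dworkMap p (b k i))
    (k : ℕ) {r : ℕ} (hr : r < p) (m : ℕ) :
    hyperCoeff (fun i => dworkMap p (a k i + r)) (fun i => dworkMap p (b k i + r)) m ∈ Zloc p := by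
  have h1 : ∀ i, dworkMap p (a k i + r) = a (k + 1) i + tau p (a k i) r := fun i => by
    rw [dworkMap_add ((h k).unit_a i).mem hr.le, ha]
  have h2 : ∀ i, dworkMap p (b k i + r) = b (k + 1) i + tau p (b k i) r := fun i => by
    rw [dworkMap_add ((h k).unit_b i).mem hr.le, hb]
  simp only [h1, h2]
  refine hyperCoeff_shift_mem h ha hb m (k + 1) _ _ (fun i => tau_le_one _ _) ?_
  rw [funext (hb k)]
  exact (h k).compatShift_tau hr

/-- The reduction modulo `p` of the hypergeometric series with parameters `𝔇_p(a_i + r)` and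
`𝔇_p(b_i + r)`. -/
noncomputable def redSeries (p : ℕ) [Fact p.Prime] {n : ℕ} (a b : Fin n → ℚ) (r : ℕ) :
    PowerSeries (ZMod p) :=
  PowerSeries.mk fun m =>
    ((hyperCoeff (fun i => dworkMap p (a i + r)) (fun i => dworkMap p (b i + r)) m : ℚ) : ZMod p)

theorem redSeries_step (h : ∀ k, Admissible p (a k) (b k))
    (ha : ∀ k i, a (k + 1) i = dworkMap p (a k i)) (hb : ∀ k i, b (k + 1) i = dworkMap p (b k i))
    (k : ℕ) {r : ℕ} (hr : r < p) (I : Finset ℕ) (hI : ∀ s, s ∈ I ↔ s ∈ sSet p (a (k + 1)) (b (k + 1))) :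
    ∃ q : ℕ → (ZMod p)[X], (∀ s, (q s).natDegree < p) ∧
      redSeries p (a k) (b k) r = ∑ s ∈ I, (q s : PowerSeries (ZMod p)) *
        redSeries p (a (k + 1)) (b (k + 1)) s ^ p := by
  classical
  set e : Fin n → ℕ := fun i => tau p (a k i) r with he_def
  set e' : Fin n → ℕ := fun i => tau p (b k i) r with he'_def
  have he : ∀ i, e i ≤ 1 := fun i => tau_le_one _ _
  have he' : CompatShift (b (k + 1)) e' := by
    rw [funext (hb k)]
    exact (h k).compatShift_tau hr
  have h1 : ∀ i, dworkMap p (a k i + r) = a (k + 1) i + e i := fun i => by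
    rw [dworkMap_add ((h k).unit_a i).mem hr.le, ha]
  have h2 : ∀ i, dworkMap p (b k i + r) = b (k + 1) i + e' i := fun i => by
    rw [dworkMap_add ((h k).unit_b i).mem hr.le, hb]
  set H : ℕ → ℚ := hyperCoeff (fun i => a (k + 1) i + e i) (fun i => b (k + 1) i + e' i) with hH
  -- Each digit ρ is assigned one exponent s. The value 0 is a default when ρ ≥ p or H(ρ) vanishes
  -- modulo p; in the latter case both branches of the conditional are zero.
  have key : ∀ ρ, ∃ s, ρ < p → ∀ m, (H (m * p + ρ) : ZMod p) =
      if s ∈ I then (H ρ : ZMod p) *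
        PowerSeries.coeff m (redSeries p (a (k + 1)) (b (k + 1)) s) else 0 := by
    intro ρ
    by_cases hρ : ρ < p
    swap
    · exact ⟨0, fun h => absurd h hρ⟩
    obtain ⟨hmem, hcase⟩ := (h (k + 1)).hyperCoeff_shift he he' hρ
    have hrec : ∀ m, (H (m * p + ρ) : ZMod p) = (H ρ : ZMod p) *
        (hyperCoeff (fun i => dworkMap p (a (k + 1) i + e i + ρ))
          (fun i => dworkMap p (b (k + 1) i + e' i + ρ)) m : ℚ) := by
      intro m
      obtain ⟨u, hu, hm⟩ := hyperCoeff_mul_add (p := p) (A := fun i => a (k + 1) i + e i)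
        (B := fun i => b (k + 1) i + e' i)
        (fun i => add_mem ((h (k + 1)).unit_a i).mem (natCast_mem_Zloc _))
        (fun i => add_mem ((h (k + 1)).unit_b i).mem (natCast_mem_Zloc _)) m ρ
      have hmem' : hyperCoeff (fun i => dworkMap p (a (k + 1) i + e i + ρ))
          (fun i => dworkMap p (b (k + 1) i + e' i + ρ)) m ∈ Zloc p := by
        obtain ⟨s, hs, hbs, -⟩ := (h (k + 1)).exists_exponent he he' hρ
        simp only [dworkMap_shift ((h (k + 1)).unit_a _) (he _) hρ,
          dworkMap_shift ((h (k + 1)).unit_b _) (he'.le_one _) hρ, ← ha, ← hb, hbs]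
        refine hyperCoeff_shift_mem h ha hb m (k + 1 + 1) _ _ (fun i => tau_le_one _ _) ?_
        rw [funext (hb (k + 1))]
        exact (h (k + 1)).compatShift_tau hs.1
      rw [hH, hm, cast_mul' (mul_mem hmem hmem') hu.1, hu.2, mul_one, cast_mul' hmem hmem']
    rcases hcase with h0 | ⟨s, hs, hbs, has⟩
    · refine ⟨0, fun _ m => ?_⟩
      rw [hrec, show (H ρ : ZMod p) = 0 from h0]
      simp
    · refine ⟨s, fun _ m => ?_⟩
      rw [if_pos ((hI s).mpr hs), hrec, redSeries, PowerSeries.coeff_mk]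
      simp only [dworkMap_shift ((h (k + 1)).unit_a _) (he _) hρ,
        dworkMap_shift ((h (k + 1)).unit_b _) (he'.le_one _) hρ, has, hbs,
        dworkMap_add ((h (k + 1)).unit_a _).mem hs.1.1.le,
        dworkMap_add ((h (k + 1)).unit_b _).mem hs.1.1.le]
  choose σ hσ using key
  -- The polynomial q_s collects the terms H(ρ) z^ρ over the digits ρ assigned to s.
  have hq : ∀ s, (∑ ρ ∈ Finset.range p, if σ ρ = s then monomial ρ (H ρ : ZMod p) else 0).natDegree < p := by
    intro s
    have : (∑ ρ ∈ Finset.range p, if σ ρ = s then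
        monomial ρ (H ρ : ZMod p) else 0).natDegree ≤ p - 1 := by
      refine natDegree_sum_le_of_forall_le _ _ fun ρ hρ => ?_
      rw [Finset.mem_range] at hρ
      split_ifs
      · exact (natDegree_monomial_le _).trans (by omega)
      · simp
    have := hp.out.pos
    omega
  refine ⟨_, hq, ?_⟩
  ext N
  rw [← Nat.div_add_mod' N p]
  have hρ : N % p < p := Nat.mod_lt _ hp.out.pos
  rw [map_sum, Finset.sum_congr rfl fun s _ => coeff_mul_pow_prime (hq s) _ _ hρ, redSeries,
    PowerSeries.coeff_mk]
  simp only [h1, h2]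
  rw [← hH, hσ _ hρ]
  have hc : ∀ s, (∑ ρ ∈ Finset.range p, if σ ρ = s then
      monomial ρ (H ρ : ZMod p) else 0).coeff (N % p) =
        if σ (N % p) = s then (H (N % p) : ZMod p) else 0 := by
    intro s
    rw [finsetSum_coeff, Finset.sum_eq_single_of_mem (N % p) (Finset.mem_range.mpr hρ)]
    · split_ifs <;> simp
    · intro ρ _ hne
      split_ifs
      · exact coeff_monomial_of_ne _ hne.symm
      · simp
  simp only [hc, ite_mul, zero_mul, Finset.sum_ite_eq]

end Chain

/-! ### Periodicity of the Dwork map on (0, 1] ∩ ℤ_(p). -/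

section Periodicity

variable {p : ℕ} [hp : Fact p.Prime]

theorem dworkMap_mem_Ioc {x : ℚ} (h : x ∈ Set.Ioc 0 1) : dworkMap p x ∈ Set.Ioc 0 1 := by
  have hp0 : (0 : ℚ) < p := by exact_mod_cast hp.out.pos
  have h1 := mul_dworkMap (p := p) x
  have h2 : (idx p x : ℚ) + 1 ≤ p := by exact_mod_cast idx_lt (p := p) x
  have h3 : (0 : ℚ) ≤ idx p x := by positivity
  constructor
  · apply pos_of_mul_pos_right _ hp0.le
    rw [h1]
    linarith [h.1]
  · rw [← mul_le_mul_iff_right₀ hp0, h1]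
    linarith [h.2]

theorem iterate_dworkMap_mem_Ioc {x : ℚ} (h : x ∈ Set.Ioc 0 1) (k : ℕ) :
    (dworkMap p)^[k] x ∈ Set.Ioc 0 1 := by
  induction k with
  | zero => exact h
  | succ k ih => rw [Function.iterate_succ_apply']; exact dworkMap_mem_Ioc ih

theorem iterate_dworkMap_mem_Zloc {x : ℚ} (h : x ∈ Zloc p) (k : ℕ) :
    (dworkMap p)^[k] x ∈ Zloc p := by
  induction k with
  | zero => exact h
  | succ k ih => rw [Function.iterate_succ_apply']; exact dworkMap_mem ih

theorem iterate_dworkMap_one (k : ℕ) : (dworkMap p)^[k] 1 = 1 :=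
  Function.iterate_fixed dworkMap_one k

theorem pow_mul_iterate_dworkMap (x : ℚ) (k : ℕ) :
    ∃ N : ℤ, (p : ℚ) ^ k * (dworkMap p)^[k] x = x + N := by
  induction k with
  | zero => exact ⟨0, by simp⟩
  | succ k ih =>
    obtain ⟨N, hN⟩ := ih
    refine ⟨N + p ^ k * idx p ((dworkMap p)^[k] x), ?_⟩
    rw [Function.iterate_succ_apply', pow_succ, mul_assoc, mul_dworkMap, mul_add, hN]
    push_cast
    ring

/-- Put y = 𝔇_p^l(x). Both p^l y - x and (p^l - 1)x are integers, hence so is p^l(y - x). As y - x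
lies in ℤ_(p), it is itself an integer; it also lies in (-1, 1), so it is 0. -/
theorem isPeriodicPt_dworkMap {x : ℚ} (h : x ∈ Set.Ioc 0 1) (hx : x ∈ Zloc p) {l : ℕ}
    (hl : x.den ∣ p ^ l - 1) : Function.IsPeriodicPt (dworkMap p) l x := by
  obtain ⟨N, hN⟩ := pow_mul_iterate_dworkMap (p := p) x l
  obtain ⟨c, hc⟩ := hl
  have hpl : 1 ≤ p ^ l := Nat.one_le_pow _ _ hp.out.pos
  have hc' : (p : ℚ) ^ l = x.den * c + 1 := by
    have : p ^ l = x.den * c + 1 := by omega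
    exact_mod_cast this
  set y := (dworkMap p)^[l] x with hy
  have hyI : y ∈ Set.Ioc (0 : ℚ) 1 := iterate_dworkMap_mem_Ioc h l
  have hyx : y - x ∈ Zloc p := sub_mem (iterate_dworkMap_mem_Zloc hx l) hx
  have hmul : (p : ℚ) ^ l * (y - x) = ((N - x.num * c : ℤ) : ℚ) := by
    have hg : x * x.den = x.num := Rat.mul_den_eq_num x
    push_cast
    rw [mul_sub, hN, hc', ← hg]
    ring
  have hden : (y - x).den ∣ p ^ l := by
    have hp0 : (p : ℚ) ^ l ≠ 0 := pow_ne_zero _ (by exact_mod_cast hp.out.ne_zero)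
    have : y - x = ((N - x.num * c : ℤ) : ℚ) / ((p ^ l : ℕ) : ℤ) := by
      rw [← hmul]
      push_cast
      field_simp
    rw [this]
    exact_mod_cast Rat.den_dvd (N - x.num * c) ((p ^ l : ℕ) : ℤ)
  have hcop : Nat.Coprime (y - x).den (p ^ l) :=
    (((Nat.Prime.coprime_iff_not_dvd hp.out).mpr hyx).symm).pow_right l
  have hden1 : (y - x).den = 1 := Nat.Coprime.eq_one_of_dvd hcop hden
  have hint : ((y - x).num : ℚ) = y - x := Rat.den_eq_one_iff _ |>.mp hden1
  have hlt : (y - x).num < 1 := by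
    have : ((y - x).num : ℚ) < 1 := by rw [hint]; linarith [h.1, hyI.2]
    exact_mod_cast this
  have hgt : -1 < (y - x).num := by
    have : (-1 : ℚ) < (y - x).num := by rw [hint]; linarith [h.2, hyI.1]
    exact_mod_cast this
  have h0 : (y - x).num = 0 := by omega
  rw [h0] at hint
  exact sub_eq_zero.mp (by simpa using hint.symm)

theorem iterate_dworkMap_injective_of_isPeriodicPt {l : ℕ} (hl : 0 < l) {x y : ℚ}
    (hx : Function.IsPeriodicPt (dworkMap p) l x) (hy : Function.IsPeriodicPt (dworkMap p) l y)
    {k : ℕ} (h : (dworkMap p)^[k] x = (dworkMap p)^[k] y) : x = y := by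
  -- A further kl - k iterations complete a multiple of the period and undo the first k.
  have hk : k ≤ k * l := Nat.le_mul_of_pos_right k hl
  have h1 := (hx.const_mul k).eq
  have h2 := (hy.const_mul k).eq
  rw [← Nat.sub_add_cancel hk, Function.iterate_add_apply] at h1 h2
  rw [← h1, ← h2, h]

theorem den_dvd_commonDen_left {n : ℕ} (α β : Fin n → ℚ) (i : Fin n) :
    (α i).den ∣ commonDen α β :=
  (Finset.dvd_lcm (f := fun i => (α i).den) (Finset.mem_univ i)).trans (Nat.dvd_lcm_left _ _)

theorem den_dvd_commonDen_right {n : ℕ} (α β : Fin n → ℚ) (i : Fin n) :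
    (β i).den ∣ commonDen α β :=
  (Finset.dvd_lcm (f := fun i => (β i).den) (Finset.mem_univ i)).trans (Nat.dvd_lcm_right _ _)

theorem coprime_commonDen {n : ℕ} {α β : Fin n → ℚ} (hα : ∀ i, α i ∈ Zloc p)
    (hβ : ∀ i, β i ∈ Zloc p) : p.Coprime (commonDen α β) := by
  have hdvd : commonDen α β ∣ (∏ i, (α i).den) * ∏ i, (β i).den :=
    (Nat.lcm_dvd_mul _ _).trans (mul_dvd_mul
      (Finset.lcm_dvd fun i hi => Finset.dvd_prod_of_mem (fun i => (α i).den) hi)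
      (Finset.lcm_dvd fun i hi => Finset.dvd_prod_of_mem (fun i => (β i).den) hi))
  refine Nat.Coprime.coprime_dvd_right hdvd (Nat.Coprime.mul_right ?_ ?_)
  · exact Nat.Coprime.prod_right fun i _ => (Nat.Prime.coprime_iff_not_dvd hp.out).mpr (hα i)
  · exact Nat.Coprime.prod_right fun i _ => (Nat.Prime.coprime_iff_not_dvd hp.out).mpr (hβ i)

theorem orderOf_pos_and_dvd {d : ℕ} (hd : p.Coprime d) :
    0 < orderOf (p : ZMod d) ∧ d ∣ p ^ orderOf (p : ZMod d) - 1 := by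
  have hd0 : d ≠ 0 := by
    rintro rfl
    exact hp.out.one_lt.ne' (by simpa using hd)
  have : NeZero d := ⟨hd0⟩
  have hpos : 1 ≤ p ^ orderOf (p : ZMod d) := Nat.one_le_pow _ _ hp.out.pos
  constructor
  · rw [← ZMod.coe_unitOfCoprime p hd, orderOf_units]
    exact orderOf_pos _
  · rw [← ZMod.natCast_eq_zero_iff, Nat.cast_sub hpos]
    push_cast
    rw [pow_orderOf_eq_one, sub_self]

end Periodicity

/-! ### Admissibility at every level and identification of the shifted series. -/

section Levels

variable {p : ℕ} [hp : Fact p.Prime]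

/-- The case r = 0 of the factorization: up to a principal unit, the m-th coefficient of the next
level is the mp-th coefficient of the current one. -/
theorem hyperCoeff_dworkIter_mem {n : ℕ} {α β : Fin n → ℚ} (hα : ∀ i, α i ∈ Zloc p)
    (hβ : ∀ i, β i ∈ Zloc p) (hf : IsIntegralSeries p (hyperSeries α β)) (k m : ℕ) :
    hyperCoeff (dworkIter p k α) (dworkIter p k β) m ∈ Zloc p := by
  induction k generalizing m with
  | zero =>
    have h := hf m
    rwa [hyperSeries, PowerSeries.coeff_mk] at h
  | succ k ih =>
    obtain ⟨u, hu, h⟩ := hyperCoeff_mul_add (p := p) (A := dworkIter p k α)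
      (B := dworkIter p k β) (fun i => iterate_dworkMap_mem_Zloc (hα i) k)
      (fun i => iterate_dworkMap_mem_Zloc (hβ i) k) m 0
    simp only [hyperCoeff_zero, one_mul, Nat.cast_zero, add_zero] at h
    have h' : hyperCoeff (dworkIter p (k + 1) α) (dworkIter p (k + 1) β) m =
        hyperCoeff (dworkIter p k α) (dworkIter p k β) (m * p) * u⁻¹ := by
      rw [h, mul_inv_cancel_right₀ hu.isUnitLoc.ne_zero]
      simp only [dworkIter, ← Function.iterate_succ_apply' (dworkMap p)]
      rfl
    rw [h']
    exact mul_mem (ih _) hu.inv.1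

theorem admissible_dworkIter {n l : ℕ} {α β : Fin n → ℚ} (hl : 0 < l)
    (hP : PropertyP p l α β) (hα : ∀ i, Function.IsPeriodicPt (dworkMap p) l (α i))
    (hβ : ∀ i, Function.IsPeriodicPt (dworkMap p) l (β i)) (hβ1 : ∃ j, β j = 1)
    (hf : IsIntegralSeries p (hyperSeries α β)) (k : ℕ) :
    Admissible p (dworkIter p k α) (dworkIter p k β) := by
  -- The property P_{p,l} only speaks of levels 1 to l; periodicity moves every level there, with
  -- level 0 represented by l.
  have hred : ∀ k, ∃ k', 1 ≤ k' ∧ k' ≤ l ∧ dworkIter p k α = dworkIter p k' α ∧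
      dworkIter p k β = dworkIter p k' β := by
    intro k
    have hper : ∀ x, Function.IsPeriodicPt (dworkMap p) l x →
        (dworkMap p)^[k] x = (dworkMap p)^[(k + l - 1) % l + 1] x := by
      intro x hx
      rw [Function.iterate_succ_apply', hx.iterate_mod_apply,
        ← Function.iterate_succ_apply' (dworkMap p),
        show (k + l - 1).succ = k + l by omega, Function.iterate_add_apply, hx.eq]
    exact ⟨(k + l - 1) % l + 1, by omega, Nat.mod_lt _ hl, funext fun i => hper _ (hα i),
      funext fun i => hper _ (hβ i)⟩
  have hinj : ∀ k i j, dworkIter p k β i = dworkIter p k β j → β i = β j := fun k i j h =>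
    iterate_dworkMap_injective_of_isPeriodicPt hl (hβ i) (hβ j) h
  obtain ⟨j₁, hj₁⟩ := hβ1
  have hone : ∀ k, dworkIter p k β j₁ = 1 := fun k => by
    rw [dworkIter, hj₁, iterate_dworkMap_one]
  have hsucc : ∀ (γ : Fin n → ℚ) k i, dworkMap p (dworkIter p k γ i) = dworkIter p (k + 1) γ i :=
    fun γ k i => (Function.iterate_succ_apply' (dworkMap p) k (γ i)).symm
  obtain ⟨k', h1, h2, ha, hb⟩ := hred k
  obtain ⟨k'', h1', h2', ha', hb'⟩ := hred (k + 1)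
  refine
    { unit_a := fun i => ?_, unit_b := fun i => ?_, unit_Da := fun i => ?_,
      unit_Db := fun i => ?_, unit_sub_ab := fun i j => ?_, unit_sub_bb := fun i j hij => ?_,
      unit_one_sub_bb := fun i j => ?_, idx_ne := fun j hj => ?_,
      exists_eq_one := ⟨j₁, hone k⟩, injOn := fun i j hij => ?_,
      coeff_mem := fun r _ => hyperCoeff_dworkIter_mem hP.memα hP.memβ hf k r }
  · rw [ha]
    exact (hP.P1 k' h1 h2).1 i
  · rw [hb]
    exact (hP.P1 k' h1 h2).2 i
  · rw [hsucc, ha']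
    exact (hP.P1 k'' h1' h2').1 i
  · rw [hsucc, hb']
    exact (hP.P1 k'' h1' h2').2 i
  · rw [ha, hb]
    exact hP.P2 k' h1 h2 i j
  · rw [hb]
    refine (hP.P3 k' h1 h2 i j).mpr fun h => hij ?_
    simp only [dworkIter, h]
  · rw [hb]
    exact (hP.P5 k' h1 h2 i j).2
  · have hβj : β j ≠ 1 := by
      intro h
      apply hj
      rw [dworkIter, h, iterate_dworkMap_one]
    have hmod : dworkIter p k β j = dworkIter p (k % l) β j :=
      ((hβ j).iterate_mod_apply k).symm
    -- (P4) compares consecutive levels, so here the lower one is reduced to the range 0, …, l - 1.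
    have := hP.P4 (k % l + 1) (by omega) (Nat.mod_lt _ hl) j hβj
    rw [Nat.add_sub_cancel, ← hsucc, ← hmod] at this
    exact this
  · rw [hsucc, hsucc] at hij
    have h := hinj _ i j hij
    simp only [dworkIter, h]

/-- The link with `shiftedSeries`: 𝔇_p(a_s + r) exceeds 𝔇_p(a_s) by 1 precisely on 𝒫_{a,r}. -/
theorem prod_cSet_mul_prod_pSet {n : ℕ} {a : Fin n → ℚ} (ha : ∀ i, IsUnitLoc p (a i))
    (hDa : ∀ i, IsUnitLoc p (dworkMap p (a i))) {r : ℕ} (hr : r < p) (m : ℕ) :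
    (∏ s ∈ cSet p a r, poch (dworkMap p (a s)) m) *
      ∏ s ∈ pSet p a r, poch (dworkMap p (a s) + 1) m =
        ∏ s, poch (dworkMap p (a s + r)) m := by
  classical
  rw [mul_comm, ← Finset.prod_filter_mul_prod_filter_not Finset.univ
    (fun s => MemPZloc p (poch (a s) r))]
  congr 1
  · refine Finset.prod_congr (by ext; simp [pSet]) fun s hs => ?_
    rw [Finset.mem_filter, memPZloc_poch_iff (ha s).mem (hDa s) hr.le] at hs
    rw [dworkMap_add (ha s).mem hr.le, hs.2, Nat.cast_one]
  · refine Finset.prod_congr (by ext; simp [cSet]) fun s hs => ?_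
    rw [Finset.mem_filter, memPZloc_poch_iff (ha s).mem (hDa s) hr.le] at hs
    have := tau_le_one (p := p) (a s) r
    rw [dworkMap_add (ha s).mem hr.le, show tau p (a s) r = 0 by omega, Nat.cast_zero, add_zero]

end Levels

/-! ### Lifting from 𝔽_p to ℤ_(p). -/

section Lifting

variable {p : ℕ} [hp : Fact p.Prime]

theorem red_surjective : Function.Surjective (red p) := fun x =>
  ⟨(x.val : Zloc p), by simp⟩

theorem exists_polynomial_lift (q : (ZMod p)[X]) :
    ∃ Q : (Zloc p)[X], Q.map (red p) = q ∧ Q.natDegree = q.natDegree :=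
  exists_natDegree_eq_of_mem_lifts
    ((mem_lifts q).mpr (Polynomial.map_surjective _ red_surjective q))

theorem natCast_dvd_of_map_red_eq_zero {f : PowerSeries (Zloc p)}
    (hf : f.map (red p) = 0) : (p : PowerSeries (Zloc p)) ∣ f := by
  have h : ∀ m, ∃ y : Zloc p, PowerSeries.coeff m f = p * y := by
    intro m
    have h0 : red p (PowerSeries.coeff m f) = 0 := by
      rw [← PowerSeries.coeff_map, hf, map_zero]
    obtain ⟨y, hy, hxy⟩ := memPZloc_iff.mpr ⟨(PowerSeries.coeff m f).2, h0⟩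
    exact ⟨⟨y, hy⟩, Subtype.ext hxy⟩
  choose y hy using h
  refine ⟨PowerSeries.mk y, ?_⟩
  ext1 m
  rw [hy, ← map_natCast (PowerSeries.C (R := Zloc p)), PowerSeries.coeff_C_mul,
    PowerSeries.coeff_mk]

end Lifting

end HypergeometricModP

/-! ### The proposition. -/

open HypergeometricModP in
theorem proposition4p1 (n : ℕ) (α β : Fin (n + 1) → ℚ)
    (hα : ∀ i, 0 < α i ∧ α i ≤ 1) (hβ : ∀ i, 0 < β i ∧ β i ≤ 1) (hβ1 : β (Fin.last n) = 1)
    (p : ℕ) [Fact p.Prime]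
    (hf : IsIntegralSeries p (hyperSeries α β))
    (l : ℕ) (hl : l = orderOf ((p : ℕ) : ZMod (commonDen α β)))
    (hP : PropertyP p l α β)
    (hαu : ∀ i, IsUnitLoc p (α i)) (hβu : ∀ j, IsUnitLoc p (β j))
    (t : ℕ) (r : Fin (t + 1) → ℕ) (hr : Function.Injective r)
    (hrS : Set.range r = sSet p (dworkIter p (l - 1) α) (dworkIter p (l - 1) β))
    (hr0 : r 0 = 0) :
    ∃ F : Fin (t + 1) → PowerSeries (Zloc p),
      (∀ i, (F i).map (Zloc p).subtype = shiftedSeries p l α β (r i) ∧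
        PowerSeries.constantCoeff (F i) = 1) ∧
      ∃ Q : Fin (t + 1) → Fin (t + 1) → Polynomial (Zloc p),
        (∀ i j, (Q i j).natDegree < p ^ l) ∧
        ∀ i, (p : PowerSeries (Zloc p)) ∣
          F i - ∑ j, (Q i j : PowerSeries (Zloc p)) * F j ^ p ^ l := by
  classical
  obtain ⟨hlpos, hldvd⟩ := orderOf_pos_and_dvd (coprime_commonDen hP.memα hP.memβ)
  rw [← hl] at hlpos hldvd
  have hαper : ∀ i, Function.IsPeriodicPt (dworkMap p) l (α i) := fun i =>
    isPeriodicPt_dworkMap (hα i) (hP.memα i) ((den_dvd_commonDen_left α β i).trans hldvd)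
  have hβper : ∀ i, Function.IsPeriodicPt (dworkMap p) l (β i) := fun i =>
    isPeriodicPt_dworkMap (hβ i) (hP.memβ i) ((den_dvd_commonDen_right α β i).trans hldvd)
  obtain ⟨l, rfl⟩ : ∃ l', l = l' + 1 := ⟨l - 1, by omega⟩
  rw [Nat.add_sub_cancel] at hrS
  -- From here `l` is the original order minus one. The orbit starts at level l so that one
  -- application of 𝔇_p gives back α and β, making the level-0 series the f_i.
  let a : ℕ → Fin (n + 1) → ℚ := fun k => dworkIter p (k + l) α
  let b : ℕ → Fin (n + 1) → ℚ := fun k => dworkIter p (k + l) β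
  have hadm : ∀ k, Admissible p (a k) (b k) := fun k =>
    admissible_dworkIter hlpos hP hαper hβper ⟨_, hβ1⟩ hf (k + l)
  have hstep : ∀ (γ : Fin (n + 1) → ℚ) k i,
      dworkIter p (k + 1 + l) γ i = dworkMap p (dworkIter p (k + l) γ i) := fun γ k i => by
    rw [show k + 1 + l = k + l + 1 by ring]
    exact Function.iterate_succ_apply' (dworkMap p) (k + l) (γ i)
  have ha : ∀ k i, a (k + 1) i = dworkMap p (a k i) := hstep α
  have hb : ∀ k i, b (k + 1) i = dworkMap p (b k i) := hstep β
  have hper : ∀ γ : Fin (n + 1) → ℚ, (∀ i, Function.IsPeriodicPt (dworkMap p) (l + 1) (γ i)) →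
      dworkIter p (l + 1 + l) γ = dworkIter p (0 + l) γ := fun γ hγ => funext fun i => by
    rw [dworkIter, dworkIter, add_comm (l + 1), Function.iterate_add_apply, (hγ i).eq, zero_add]
  have hal : a (0 + (l + 1)) = a 0 := by rw [zero_add]; exact hper α hαper
  have hbl : b (0 + (l + 1)) = b 0 := by rw [zero_add]; exact hper β hβper
  have hDa : ∀ i, dworkMap p (dworkIter p l α i) = α i := fun i =>
    (Function.iterate_succ_apply' (dworkMap p) l (α i)).symm.trans (hαper i).eq
  have hDb : ∀ i, dworkMap p (dworkIter p l β i) = β i := fun i =>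
    (Function.iterate_succ_apply' (dworkMap p) l (β i)).symm.trans (hβper i).eq
  have ha0 : a 0 = dworkIter p l α := by simp only [a, zero_add]
  have hb0 : b 0 = dworkIter p l β := by simp only [b, zero_add]
  have hrS' : ∀ i, r i ∈ sSet p (a 0) (b 0) := fun i => by
    rw [ha0, hb0, ← hrS]
    exact Set.mem_range_self i
  have hrp : ∀ i, r i < p := fun i => (hrS' i).1.1
  let I : ℕ → Finset ℕ := fun k => (Finset.range p).filter (· ∈ sSet p (a k) (b k))
  have hI : ∀ k s, s ∈ I k ↔ s ∈ sSet p (a k) (b k) := fun k s => by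
    simp only [I, Finset.mem_filter, Finset.mem_range]
    exact ⟨fun h => h.2, fun h => ⟨h.1.1, h⟩⟩
  -- After a full period the exponents are again r_0, …, r_t, so the relation closes up on the f_j.
  have hImage : I (0 + (l + 1)) = Finset.univ.image r := by
    ext s
    rw [hI, hal, hbl, ha0, hb0, ← hrS]
    simp
  have hrel := exists_iterate_relation (fun k s => redSeries p (a k) (b k) s) I
    (fun k s hs => ((hI k s).mp hs).1.1)
    (fun k s hs => redSeries_step hadm ha hb k hs (I (k + 1)) (hI (k + 1))) l 0
  choose q hq hG using fun i => hrel (r i) (hrp i)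
  choose Q hQ hQdeg using fun i j => exists_polynomial_lift (q i (r j))
  let F : Fin (t + 1) → PowerSeries (Zloc p) := fun i => PowerSeries.mk fun m =>
    ⟨_, hyperCoeff_dworkMap_mem hadm ha hb 0 (hrp i) m⟩
  have hF : ∀ i, (F i).map (red p) = redSeries p (a 0) (b 0) (r i) := fun i => by
    ext m
    simp only [F, PowerSeries.coeff_map, PowerSeries.coeff_mk, redSeries, red_apply]
  refine ⟨F, fun i => ⟨?_, ?_⟩, Q, fun i j => ?_, fun i => ?_⟩
  · ext m
    have hA := prod_cSet_mul_prod_pSet (hadm 0).unit_a (hadm 0).unit_Da (hrp i) m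
    have hB := prod_cSet_mul_prod_pSet (hadm 0).unit_b (hadm 0).unit_Db (hrp i) m
    rw [ha0] at hA
    rw [hb0] at hB
    simp only [hDa] at hA
    simp only [hDb] at hB
    simp only [F, PowerSeries.coeff_map, PowerSeries.coeff_mk, shiftedSeries, Subring.subtype_apply,
      Nat.add_sub_cancel, hA, hB, hyperCoeff, ha0, hb0]
  · rw [← PowerSeries.coeff_zero_eq_constantCoeff_apply]
    simp only [F, PowerSeries.coeff_mk, hyperCoeff_zero]
    rfl
  · rw [hQdeg]
    exact hq i (r j)
  · apply natCast_dvd_of_map_red_eq_zero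
    have h := hG i
    rw [hImage, Finset.sum_image fun x _ y _ hxy => hr hxy, hal, hbl] at h
    rw [map_sub, map_sum, hF, h, sub_eq_zero]
    refine Finset.sum_congr rfl fun j _ => ?_
    rw [map_mul, map_pow, hF, ← Polynomial.polynomial_map_coe, hQ]
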